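/- Let $\mathcal I=\{(\theta,\alpha,\beta)\in(0,\frac\pi2)\times[0,\frac\pi2]^2 : (\alpha,\beta)\neq(0,\theta)\}$. For $\theta\in(0,\frac\pi2)$ put $\lambda=\cot\frac\theta2$ and let $\Sigma_\theta$ be the compact Riemann surface of genus one of the curve $w^2=(z^2+\lambda^2)(z^2+\lambda^{-2})$ (with two points over $z=\infty$). For $(\theta,\alpha,\beta)\in\mathcal I$ let $$g=\frac{z\left(i\cos\frac{\alpha-\beta}2+\cos\frac{\alpha+\beta}2\right)+\sin\frac{\alpha-\beta}2+i\sin\frac{\alpha+\beta}2}{\cos\frac{\alpha-\beta}2+i\cos\frac{\alpha+\beta}2-z\left(i\sin\frac{\alpha-\beta}2+\sin\frac{\alpha+\beta}2\right)},\qquad dh=\mu(\theta)\,\frac{dz}{w},\qquad \mu(\theta)=\frac{\pi}{\sin\theta\,K(\sin^2\theta)},$$ where $K(m)=\int_0^{\pi/2}\frac{du}{\sqrt{1-m\sin^2u}}$, and let $\Phi=\left(\frac12(g^{-1}-g),\frac i2(g^{-1}+g),1\right)dh$ on $\Sigma_\theta\setminus g^{-1}(\{0,\infty\})$. The standard example $M_{\theta,\alpha,\beta}$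 is the minimal surface with Weierstrass form $\Phi$: its lift to $\mathbb R^3$ is the set of all values $\mathrm{Re}\int_\gamma\Phi$, where $\gamma$ runs over the curves in $\Sigma_\theta\setminus g^{-1}(\{0,\infty\})$ that start at the branch point $(z,w)=(i\lambda,0)$ (this fixes the surface among its translates), and its period group is generated by the vectors $\mathrm{Re}\int_\gamma\Phi$ for closed curves $\gamma$ in $\Sigma_\theta\setminus g^{-1}(\{0,\infty\})$. The conjugate surface $M^*_{\theta,\alpha,\beta}$ is obtained in the same way from $i\Phi$ in place of $\Phi$. For every $(\theta,\alpha,\beta)\in\mathcal I$, the triple $(\frac\pi2-\theta,\alpha,\frac\pi2-\beta)$ also lies in $\mathcal I$, and $M_{\frac\pi2-\theta,\alpha,\frac\pi2-\beta}$ is the image of $M^*_{\theta,\alpha,\beta}$ under the homothety of ratio $r=\frac{\mu(\frac\pi2-\theta)}{\mu(\theta)\tan\theta}>0$ followed by the reflection in a plane orthogonal to the $x_2$-axis; that is, this map sends the lift of the one surface onto the lift of the other, and its linear part sends the one period group onto the other. Hence the family of standard examples is self-conjugate: for every $(\theta,\alpha,\beta)\in\mathcal I$ there is $(\theta',\alpha',\beta')\in\mathcal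 I$, and conversely for every $(\theta',\alpha',\beta')\in\mathcal I$ there is $(\theta,\alpha,\beta)\in\mathcal I$, such that $M_{\theta',\alpha',\beta'}$ is the image of $M^*_{\theta,\alpha,\beta}$ under a homothety of positive ratio followed by a reflection in a plane orthogonal to the $x_2$-axis. -/

import Mathlib

open Set

noncomputable section

namespace StandardExamples

/-- The parameter range `I`: triples `(θ, α, β)` in `(0, π/2) × [0, π/2]²` with `(α, β) ≠ (0, θ)`. -/
def paramRange : Set (ℝ × ℝ × ℝ) :=
  {p | p.1 ∈ Ioo 0 (Real.pi / 2) ∧ p.2.1 ∈ Icc 0 (Real.pi / 2) ∧ p.2.2 ∈ Icc 0 (Real.pi / 2) ∧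
    (p.2.1, p.2.2) ≠ (0, p.1)}

/-- `λ(θ) = cot (θ / 2)`. -/
def lam (θ : ℝ) : ℝ := Real.cot (θ / 2)

/-- The polynomial `(z² + λ²)(z² + λ⁻²)`, homogenized by `z = y / x`. -/
def quartic (θ : ℝ) (x y : ℂ) : ℂ :=
  (y ^ 2 + (lam θ : ℂ) ^ 2 * x ^ 2) * (y ^ 2 + ((lam θ : ℂ) ^ 2)⁻¹ * x ^ 2)

/-- A `C¹` curve, parametrized by `[0, 1]`, in the compact Riemann surface
`Σ_θ : w² = (z² + λ²)(z² + λ⁻²)`.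
The surface is described by homogeneous coordinates `(x, y, w)` with `(x, y) ≠ (0, 0)` and
`w² = quartic θ x y`, where `(x, y, w)` and `(c x, c y, c² w)` are the same point for `c ≠ 0`.
The affine coordinates of the point are `(y / x, w / x²)`; the two points over `z = ∞` are those
with `x = 0`.

`vel t` is the value of the holomorphic differential `dz / w` on the velocity of the curve at time
`t`. It is determined by the three equations `vel_x`, `vel_y`, `vel_z`, as `w` and the two partial
derivatives of the quartic never vanish simultaneously. For `x = 1` these equations include
`z' = vel * w` and `w' = vel * p'(z) / 2`, where `p(z) = (z² + λ²)(z² + λ⁻²)`; the second one gives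
the value of `dz / w` where `w = 0`. -/
structure Curve (θ : ℝ) where
  x : ℝ → ℂ
  y : ℝ → ℂ
  w : ℝ → ℂ
  vel : ℝ → ℂ
  contDiff_x : ContDiff ℝ 1 x
  contDiff_y : ContDiff ℝ 1 y
  contDiff_w : ContDiff ℝ 1 w
  ne_zero : ∀ t ∈ Icc (0 : ℝ) 1, (x t, y t) ≠ (0, 0)
  equation : ∀ t ∈ Icc (0 : ℝ) 1, w t ^ 2 = quartic θ (x t) (y t)
  vel_z : ∀ t ∈ Icc (0 : ℝ) 1, x t * deriv y t - y t * deriv x t = vel t * w t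
  vel_x : ∀ t ∈ Icc (0 : ℝ) 1, x t * deriv w t - 2 * w t * deriv x t =
    vel t * (deriv (fun s : ℂ => quartic θ (x t) s) (y t) / 2)
  vel_y : ∀ t ∈ Icc (0 : ℝ) 1, y t * deriv w t - 2 * w t * deriv y t =
    -(vel t * (deriv (fun s : ℂ => quartic θ s (y t)) (x t) / 2))

/-- The curve is closed in `Σ_θ`. -/
def Curve.IsClosed {θ : ℝ} (γ : Curve θ) : Prop :=
  ∃ c : ℂ, c ≠ 0 ∧ γ.x 1 = c * γ.x 0 ∧ γ.y 1 = c * γ.y 0 ∧ γ.w 1 = c ^ 2 * γ.w 0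

/-- The curve starts at the branch point `(z, w) = (i λ, 0)` of the `z`-projection. -/
def Curve.StartsAtBase {θ : ℝ} (γ : Curve θ) : Prop :=
  γ.y 0 = Complex.I * (lam θ : ℂ) * γ.x 0

/-- Numerator of the Gauss map, homogenized by `z = y / x`. -/
def gaussNum (α β : ℝ) (x y : ℂ) : ℂ :=
  y * (Complex.I * (Real.cos ((α - β) / 2) : ℂ) + (Real.cos ((α + β) / 2) : ℂ)) +
    x * ((Real.sin ((α - β) / 2) : ℂ) + Complex.I * (Real.sin ((α + β) / 2) : ℂ))

/-- Denominator of the Gauss map, homogenized by `z = y / x`. -/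
def gaussDen (α β : ℝ) (x y : ℂ) : ℂ :=
  x * ((Real.cos ((α - β) / 2) : ℂ) + Complex.I * (Real.cos ((α + β) / 2) : ℂ)) -
    y * (Complex.I * (Real.sin ((α - β) / 2) : ℂ) + (Real.sin ((α + β) / 2) : ℂ))

/-- The stereographically projected Gauss map `g` of `M_{θ,α,β}`, away from its poles. -/
def gauss (α β : ℝ) (x y : ℂ) : ℂ := gaussNum α β x y / gaussDen α β x y

/-- The curve avoids the four ends, which are the points of `Σ_θ` where `g = 0` or `g = ∞`. -/
def Curve.AvoidsEnds {θ : ℝ} (γ : Curve θ) (α β : ℝ) : Prop :=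
  ∀ t ∈ Icc (0 : ℝ) 1, gaussNum α β (γ.x t) (γ.y t) ≠ 0 ∧ gaussDen α β (γ.x t) (γ.y t) ≠ 0

/-- The complete elliptic integral of the first kind, as a function of the parameter `m = k²`. -/
def ellipticK (m : ℝ) : ℝ :=
  ∫ u in (0 : ℝ)..(Real.pi / 2), 1 / Real.sqrt (1 - m * Real.sin u ^ 2)

/-- The real factor `μ(θ)` in the height differential `dh = μ dz / w`. -/
def mu (θ : ℝ) : ℝ := Real.pi / (Real.sin θ * ellipticK (Real.sin θ ^ 2))

/-- The coefficients of `dh` in the Weierstrass form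
`Φ = ((g⁻¹ - g) / 2, i (g⁻¹ + g) / 2, 1) dh`. -/
def weierstrassCoeff (g : ℂ) : Fin 3 → ℂ :=
  ![(g⁻¹ - g) / 2, Complex.I / 2 * (g⁻¹ + g), 1]

/-- The vector `Re (κ ∫_γ Φ)`, where `Φ` is the Weierstrass form of `M_{θ,α,β}`. -/
def displacement {θ : ℝ} (κ : ℂ) (α β : ℝ) (γ : Curve θ) : EuclideanSpace ℝ (Fin 3) :=
  WithLp.toLp 2 fun j => (κ * ∫ t in (0 : ℝ)..1,
    weierstrassCoeff (gauss α β (γ.x t) (γ.y t)) j * ((mu θ : ℂ) * γ.vel t)).re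

/-- A doubly periodic surface `M = M̃ / P`, given by the lift `M̃ ⊆ ℝ³` and the period group `P`. -/
structure PeriodicSurface where
  lift : Set (EuclideanSpace ℝ (Fin 3))
  periods : AddSubgroup (EuclideanSpace ℝ (Fin 3))

/-- The surface with Weierstrass form `κ Φ`, where `Φ` is the Weierstrass form of `M_{θ,α,β}`: its
lift is the image of the multivalued map `p ↦ Re ∫^p κ Φ` on `Σ_θ` minus the ends, placed so that
the branch point `(i λ, 0)` is mapped to the origin, and its period group is generated by the vectors
`Re ∫_γ κ Φ` for closed curves `γ` in `Σ_θ` minus the ends. -/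
def associateSurface (κ : ℂ) (θ α β : ℝ) : PeriodicSurface where
  lift := {X | ∃ γ : Curve θ, γ.AvoidsEnds α β ∧ γ.StartsAtBase ∧ X = displacement κ α β γ}
  periods := AddSubgroup.closure
    {X | ∃ γ : Curve θ, γ.AvoidsEnds α β ∧ γ.IsClosed ∧ X = displacement κ α β γ}

/-- The standard example `M_{θ,α,β}`. -/
def standardExample (θ α β : ℝ) : PeriodicSurface := associateSurface 1 θ α β

/-- The conjugate surface `M*_{θ,α,β}`, with Weierstrass form `i Φ`: its coordinate functions are
harmonic conjugates, up to sign, of those of `M_{θ,α,β}`. -/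
def conjugateExample (θ α β : ℝ) : PeriodicSurface := associateSurface Complex.I θ α β

/-- The reflection of `ℝ³` in the plane `x₂ = b` (coordinates are numbered `0, 1, 2` here). -/
def reflectX2 (b : ℝ) (X : EuclideanSpace ℝ (Fin 3)) : EuclideanSpace ℝ (Fin 3) :=
  !₂[X 0, 2 * b - X 1, X 2]

/-- `N` is the image of `M` under the homothety of ratio `r` followed by the reflection in some plane
orthogonal to the `x₂`-axis. Period vectors transform by the linear part of this map. -/
def CoincideUpToReflection (r : ℝ) (M N : PeriodicSurface) : Prop :=
  ∃ b : ℝ, N.lift = (fun X => reflectX2 b (r • X)) '' M.lift ∧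
    (N.periods : Set (EuclideanSpace ℝ (Fin 3))) =
      (fun X => reflectX2 0 (r • X)) '' (M.periods : Set (EuclideanSpace ℝ (Fin 3)))

end StandardExamples

end

open StandardExamples

/-!
The antiholomorphic map `z ↦ (z̄ - i) / (1 - i z̄)` of the sphere lifts to an isomorphism
`Σ_θ → Σ_{π/2-θ}`, because `(z² + λ²)(z² + λ⁻²) = (1 + z²)² + (2 cot θ z)²` and the map exchanges,
up to conjugation and constants, `1 + z²` and `z`. The lift takes the base point to the base point,
pulls `dz / w` back to `-i cot θ` times the conjugate of `dz / w`, and pulls the Gauss map with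
parameters `(α, π/2-β)` back to the conjugate of the Gauss map with parameters `(α, β)`.
Replacing `g` by `ḡ` conjugates the Weierstrass coefficients and changes the sign of the second one,
which is the reflection. As `Re (κ ū) = Re (κ̄ u)`, the form `κ Φ` on `Σ_{π/2-θ}` gives the same
integrals, up to reflection and scale, as the form `i κ̄ Φ` on `Σ_θ`, and `κ ↦ i κ̄` is an
involution; so each inclusion between the two surfaces is an instance of the other.
-/

namespace StandardExamples

open Complex (I)
open scoped ComplexConjugate Real

/-- The antilinear form `ū - i v̄`. The antiholomorphic map `z ↦ (z̄ - i) / (1 - i z̄)` is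
`(x, y) ↦ (dualCoord x y, dualCoord y x)` in the homogeneous coordinates `z = y / x`. -/
noncomputable def dualCoord (u v : ℂ) : ℂ := conj u - I * conj v

theorem dualCoord_add_I_mul_dualCoord (x y : ℂ) :
    dualCoord x y + I * dualCoord y x = 2 * conj x := by
  simp only [dualCoord]
  linear_combination -conj x * Complex.I_sq

theorem dualCoord_sq_add_sq (x y : ℂ) :
    dualCoord x y ^ 2 + dualCoord y x ^ 2 = -4 * I * conj (x * y) := by
  simp only [dualCoord, map_mul]
  linear_combination (conj x ^ 2 + conj y ^ 2) * Complex.I_sq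

theorem dualCoord_mul_dualCoord (x y : ℂ) :
    dualCoord x y * dualCoord y x = -I * conj (x ^ 2 + y ^ 2) := by
  simp only [dualCoord, map_add, map_pow]
  linear_combination conj x * conj y * Complex.I_sq

theorem dualCoord_mul_sub_mul (x y u v : ℂ) :
    dualCoord x y * dualCoord v u - dualCoord y x * dualCoord u v = 2 * conj (x * v - y * u) := by
  simp only [dualCoord, map_sub, map_mul]
  linear_combination (conj y * conj u - conj x * conj v) * Complex.I_sq

theorem dualCoord_mul_sub_two_mul (c x y w u v r : ℂ) :
    dualCoord x y * (c * conj r) - 2 * (c * conj w) * dualCoord u v =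
      c * dualCoord (x * r - 2 * w * u) (y * r - 2 * w * v) := by
  simp only [dualCoord, map_sub, map_mul, map_ofNat]
  ring

theorem eq_zero_of_dualCoord_eq_zero {x y : ℂ} (h : dualCoord x y = 0) (h' : dualCoord y x = 0) :
    x = 0 := by
  simpa [h, h'] using dualCoord_add_I_mul_dualCoord x y

theorem contDiff_dualCoord {n : WithTop ℕ∞} {f g : ℝ → ℂ} (hf : ContDiff ℝ n f)
    (hg : ContDiff ℝ n g) : ContDiff ℝ n fun t => dualCoord (f t) (g t) :=
  (Complex.conjCLE.contDiff.comp hf).sub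
    (contDiff_const.mul (Complex.conjCLE.contDiff.comp hg))

theorem deriv_dualCoord {f g : ℝ → ℂ} {t : ℝ} (hf : DifferentiableAt ℝ f t)
    (hg : DifferentiableAt ℝ g t) :
    deriv (fun t => dualCoord (f t) (g t)) t = dualCoord (deriv f t) (deriv g t) :=
  (hf.hasDerivAt.star.sub (hg.hasDerivAt.star.const_mul I)).deriv

theorem deriv_const_mul_conj {f : ℝ → ℂ} {t : ℝ} (hf : DifferentiableAt ℝ f t) (c : ℂ) :
    deriv (fun t => c * conj (f t)) t = c * conj (deriv f t) :=
  (hf.hasDerivAt.star.const_mul c).deriv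

theorem sin_ne_zero_of_sin_two_mul_ne_zero {θ : ℝ} (hθ : Real.sin (2 * θ) ≠ 0) :
    Real.sin θ ≠ 0 := by
  rw [Real.sin_two_mul] at hθ
  exact right_ne_zero_of_mul (left_ne_zero_of_mul hθ)

theorem cos_ne_zero_of_sin_two_mul_ne_zero {θ : ℝ} (hθ : Real.sin (2 * θ) ≠ 0) :
    Real.cos θ ≠ 0 := by
  rw [Real.sin_two_mul] at hθ
  exact right_ne_zero_of_mul hθ

theorem sin_pi_div_two_sub_ne_zero {θ : ℝ} (hθ : Real.sin (2 * θ) ≠ 0) :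
    Real.sin (π / 2 - θ) ≠ 0 := by
  rw [Real.sin_pi_div_two_sub]
  exact cos_ne_zero_of_sin_two_mul_ne_zero hθ

theorem sin_two_mul_pi_div_two_sub (θ : ℝ) :
    Real.sin (2 * (π / 2 - θ)) = Real.sin (2 * θ) := by
  rw [← Real.sin_pi_sub]
  ring_nf

theorem cot_pi_div_two_sub (θ : ℝ) : Real.cot (π / 2 - θ) = Real.tan θ := by
  rw [← Real.tan_inv_eq_cot, Real.tan_pi_div_two_sub, inv_inv]

theorem tan_ne_zero_of_sin_two_mul_ne_zero {θ : ℝ} (hθ : Real.sin (2 * θ) ≠ 0) :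
    Real.tan θ ≠ 0 := by
  rw [Real.tan_eq_sin_div_cos]
  exact div_ne_zero (sin_ne_zero_of_sin_two_mul_ne_zero hθ) (cos_ne_zero_of_sin_two_mul_ne_zero hθ)

theorem ofReal_cot_mul_ofReal_tan {θ : ℝ} (hθ : Real.sin (2 * θ) ≠ 0) :
    (Real.cot θ : ℂ) * (Real.tan θ : ℂ) = 1 := by
  rw [← Real.tan_inv_eq_cot, ← Complex.ofReal_mul,
    inv_mul_cancel₀ (tan_ne_zero_of_sin_two_mul_ne_zero hθ), Complex.ofReal_one]

theorem sin_half_ne_zero {θ : ℝ} (hθ : Real.sin θ ≠ 0) : Real.sin (θ / 2) ≠ 0 :=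
  sin_ne_zero_of_sin_two_mul_ne_zero (by rwa [mul_div_cancel₀ θ two_ne_zero])

theorem cos_half_ne_zero {θ : ℝ} (hθ : Real.sin θ ≠ 0) : Real.cos (θ / 2) ≠ 0 :=
  cos_ne_zero_of_sin_two_mul_ne_zero (by rwa [mul_div_cancel₀ θ two_ne_zero])

theorem lam_ne_zero {θ : ℝ} (hθ : Real.sin θ ≠ 0) : lam θ ≠ 0 := by
  rw [lam, Real.cot_eq_cos_div_sin]
  exact div_ne_zero (cos_half_ne_zero hθ) (sin_half_ne_zero hθ)

theorem lam_sub_inv {θ : ℝ} (hθ : Real.sin θ ≠ 0) : lam θ - (lam θ)⁻¹ = 2 * Real.cot θ := by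
  have hs := sin_half_ne_zero hθ
  have hc := cos_half_ne_zero hθ
  have hsin : Real.sin θ = 2 * Real.sin (θ / 2) * Real.cos (θ / 2) := by
    rw [← Real.sin_two_mul, mul_div_cancel₀ θ two_ne_zero]
  have hcos : Real.cos θ = Real.cos (θ / 2) ^ 2 - Real.sin (θ / 2) ^ 2 := by
    rw [← Real.cos_two_mul', mul_div_cancel₀ θ two_ne_zero]
  rw [lam, Real.cot_eq_cos_div_sin, Real.cot_eq_cos_div_sin, hsin, hcos]
  field_simp

theorem lam_pi_div_two_sub_mul {θ : ℝ} (hθ : Real.sin (2 * θ) ≠ 0) :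
    lam (π / 2 - θ) * (lam θ - 1) = lam θ + 1 := by
  have hs : Real.sin (θ / 2) ≠ 0 := sin_half_ne_zero (sin_ne_zero_of_sin_two_mul_ne_zero hθ)
  have hs' : Real.sin ((π / 2 - θ) / 2) ≠ 0 :=
    sin_half_ne_zero (sin_pi_div_two_sub_ne_zero hθ)
  have hhalf : (π / 2 - θ) / 2 = π / 4 - θ / 2 := by ring
  rw [hhalf] at hs'
  rw [lam, lam, hhalf, Real.cot_eq_cos_div_sin, Real.cot_eq_cos_div_sin, div_mul_eq_mul_div,
    div_eq_iff hs', Real.cos_sub, Real.sin_sub, Real.cos_pi_div_four, Real.sin_pi_div_four]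
  field_simp

theorem quartic_eq_sq_add_sq {θ : ℝ} (hθ : Real.sin θ ≠ 0) (x y : ℂ) :
    quartic θ x y = (x ^ 2 + y ^ 2) ^ 2 + (2 * (Real.cot θ : ℂ) * (x * y)) ^ 2 := by
  have hlam : (lam θ : ℂ) ≠ 0 := Complex.ofReal_ne_zero.mpr (lam_ne_zero hθ)
  have hcot : 2 * (Real.cot θ : ℂ) = lam θ - (lam θ : ℂ)⁻¹ := by
    exact_mod_cast (congrArg Complex.ofReal (lam_sub_inv hθ)).symm
  rw [hcot, quartic]
  field_simp
  ring

theorem quartic_comm {θ : ℝ} (hθ : Real.sin θ ≠ 0) (x y : ℂ) : quartic θ x y = quartic θ y x := by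
  rw [quartic_eq_sq_add_sq hθ, quartic_eq_sq_add_sq hθ, add_comm (x ^ 2), mul_comm x]

theorem deriv_quartic_snd {θ : ℝ} (hθ : Real.sin θ ≠ 0) (x y : ℂ) :
    deriv (fun s : ℂ => quartic θ x s) y =
      4 * y * (x ^ 2 + y ^ 2) + 8 * (Real.cot θ : ℂ) ^ 2 * x * (x * y) := by
  simp only [quartic_eq_sq_add_sq hθ]
  have hleft : HasDerivAt (fun s : ℂ => (x ^ 2 + s ^ 2) ^ 2) _ y :=
    (((hasDerivAt_id y).pow 2).const_add (x ^ 2)).pow 2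
  have hright : HasDerivAt (fun s : ℂ => (2 * (Real.cot θ : ℂ) * (x * s)) ^ 2) _ y :=
    (((hasDerivAt_id y).const_mul x).const_mul (2 * (Real.cot θ : ℂ))).pow 2
  rw [(hleft.fun_add hright).deriv]
  simp only [id, Pi.pow_apply]
  ring

theorem deriv_quartic_fst {θ : ℝ} (hθ : Real.sin θ ≠ 0) (x y : ℂ) :
    deriv (fun s : ℂ => quartic θ s y) x = deriv (fun s : ℂ => quartic θ y s) x := by
  simp only [quartic_comm hθ _ y]

theorem quartic_dualCoord {θ : ℝ} (hθ : Real.sin (2 * θ) ≠ 0) (x y : ℂ) :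
    quartic (π / 2 - θ) (dualCoord x y) (dualCoord y x) =
      (2 * I * (Real.tan θ : ℂ)) ^ 2 * conj (quartic θ x y) := by
  have hs := sin_ne_zero_of_sin_two_mul_ne_zero hθ
  have hs' := sin_pi_div_two_sub_ne_zero hθ
  have hcot := ofReal_cot_mul_ofReal_tan hθ
  rw [quartic_eq_sq_add_sq hs', quartic_eq_sq_add_sq hs, dualCoord_sq_add_sq,
    dualCoord_mul_dualCoord, cot_pi_div_two_sub]
  simp only [map_add, map_mul, map_pow, map_ofNat, Complex.conj_ofReal]
  linear_combination (-16 * I ^ 2 * (conj x * conj y) ^ 2) *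
    ((Real.cot θ : ℂ) * (Real.tan θ : ℂ) + 1) * hcot

theorem deriv_quartic_snd_dualCoord {θ : ℝ} (hθ : Real.sin (2 * θ) ≠ 0) (x y : ℂ) :
    deriv (fun s : ℂ => quartic (π / 2 - θ) (dualCoord x y) s) (dualCoord y x) =
      -2 * (Real.tan θ : ℂ) ^ 2 * (conj (deriv (fun s : ℂ => quartic θ x s) y) +
        I * conj (deriv (fun s : ℂ => quartic θ s y) x)) := by
  have hs := sin_ne_zero_of_sin_two_mul_ne_zero hθ
  have hs' := sin_pi_div_two_sub_ne_zero hθ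
  have hcot := ofReal_cot_mul_ofReal_tan hθ
  rw [deriv_quartic_snd hs', deriv_quartic_fst hs, deriv_quartic_snd hs, deriv_quartic_snd hs,
    dualCoord_sq_add_sq, dualCoord_mul_dualCoord, cot_pi_div_two_sub]
  simp only [dualCoord, map_add, map_mul, map_pow, map_ofNat, Complex.conj_ofReal]
  linear_combination
    16 * conj x * conj y * (conj x + I * conj y) * (Real.cot θ * Real.tan θ + 1) * hcot +
      (8 * (Real.tan θ : ℂ) ^ 2 * (conj x ^ 2 + conj y ^ 2) * conj y +
        16 * conj x ^ 2 * conj y) * Complex.I_sq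

theorem deriv_quartic_fst_dualCoord {θ : ℝ} (hθ : Real.sin (2 * θ) ≠ 0) (x y : ℂ) :
    deriv (fun s : ℂ => quartic (π / 2 - θ) s (dualCoord y x)) (dualCoord x y) =
      -2 * (Real.tan θ : ℂ) ^ 2 * (conj (deriv (fun s : ℂ => quartic θ s y) x) +
        I * conj (deriv (fun s : ℂ => quartic θ x s) y)) := by
  have hs := sin_ne_zero_of_sin_two_mul_ne_zero hθ
  have hs' := sin_pi_div_two_sub_ne_zero hθ
  rw [deriv_quartic_fst hs', deriv_quartic_snd_dualCoord hθ, deriv_quartic_fst hs,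
    deriv_quartic_fst hs]

theorem Curve.differentiable_x {θ : ℝ} (γ : Curve θ) : Differentiable ℝ γ.x :=
  γ.contDiff_x.differentiable one_ne_zero

theorem Curve.differentiable_y {θ : ℝ} (γ : Curve θ) : Differentiable ℝ γ.y :=
  γ.contDiff_y.differentiable one_ne_zero

theorem Curve.differentiable_w {θ : ℝ} (γ : Curve θ) : Differentiable ℝ γ.w :=
  γ.contDiff_w.differentiable one_ne_zero

/-- The image of a curve under the antiholomorphic isomorphism `Σ_θ → Σ_{π/2-θ}` that covers
`z ↦ (z̄ - i) / (1 - i z̄)`. The condition on `θ` says that `λ` is finite and nonzero and that the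
four branch points `±i λ`, `±i λ⁻¹` are distinct. -/
noncomputable def Curve.dual {θ : ℝ} (γ : Curve θ) (hθ : Real.sin (2 * θ) ≠ 0) :
    Curve (π / 2 - θ) where
  x t := dualCoord (γ.x t) (γ.y t)
  y t := dualCoord (γ.y t) (γ.x t)
  w t := 2 * I * Real.tan θ * conj (γ.w t)
  vel t := Real.cot θ * conj (I * γ.vel t)
  contDiff_x := contDiff_dualCoord γ.contDiff_x γ.contDiff_y
  contDiff_y := contDiff_dualCoord γ.contDiff_y γ.contDiff_x
  contDiff_w := contDiff_const.mul (Complex.conjCLE.contDiff.comp γ.contDiff_w)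
  ne_zero t ht h := by
    obtain ⟨hx, hy⟩ := Prod.mk.inj h
    exact γ.ne_zero t ht
      (Prod.ext (eq_zero_of_dualCoord_eq_zero hx hy) (eq_zero_of_dualCoord_eq_zero hy hx))
  equation t ht := by
    rw [quartic_dualCoord hθ, ← γ.equation t ht, map_pow, mul_pow]
  vel_z t ht := by
    rw [deriv_dualCoord (γ.differentiable_x t) (γ.differentiable_y t),
      deriv_dualCoord (γ.differentiable_y t) (γ.differentiable_x t), dualCoord_mul_sub_mul,
      γ.vel_z t ht]
    simp only [map_mul, Complex.conj_I]
    linear_combination (-2 * conj (γ.vel t) * conj (γ.w t)) * ofReal_cot_mul_ofReal_tan hθ +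
      2 * (Real.cot θ : ℂ) * Real.tan θ * conj (γ.vel t) * conj (γ.w t) * Complex.I_sq
  vel_x t ht := by
    rw [deriv_dualCoord (γ.differentiable_x t) (γ.differentiable_y t),
      deriv_const_mul_conj (γ.differentiable_w t), deriv_quartic_snd_dualCoord hθ,
      dualCoord_mul_sub_two_mul, γ.vel_x t ht, γ.vel_y t ht]
    simp only [dualCoord, map_neg, map_mul, map_div₀, map_ofNat, Complex.conj_I]
    linear_combination -I * Real.tan θ * conj (γ.vel t) *
      (conj (deriv (fun s : ℂ => quartic θ (γ.x t) s) (γ.y t)) +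
        I * conj (deriv (fun s : ℂ => quartic θ s (γ.y t)) (γ.x t))) * ofReal_cot_mul_ofReal_tan hθ
  vel_y t ht := by
    rw [deriv_dualCoord (γ.differentiable_y t) (γ.differentiable_x t),
      deriv_const_mul_conj (γ.differentiable_w t), deriv_quartic_fst_dualCoord hθ,
      dualCoord_mul_sub_two_mul, γ.vel_x t ht, γ.vel_y t ht]
    simp only [dualCoord, map_neg, map_mul, map_div₀, map_ofNat, Complex.conj_I]
    linear_combination I * Real.tan θ * conj (γ.vel t) *
      (conj (deriv (fun s : ℂ => quartic θ s (γ.y t)) (γ.x t)) +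
        I * conj (deriv (fun s : ℂ => quartic θ (γ.x t) s) (γ.y t))) * ofReal_cot_mul_ofReal_tan hθ

theorem Curve.IsClosed.dual {θ : ℝ} {γ : Curve θ} (h : γ.IsClosed)
    (hθ : Real.sin (2 * θ) ≠ 0) : (γ.dual hθ).IsClosed := by
  obtain ⟨c, hc, hx, hy, hw⟩ := h
  refine ⟨conj c, (map_ne_zero _).mpr hc, ?_, ?_, ?_⟩ <;>
    simp only [Curve.dual, dualCoord, hx, hy, hw, map_mul, map_pow] <;> ring

theorem Curve.StartsAtBase.dual {θ : ℝ} {γ : Curve θ} (h : γ.StartsAtBase)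
    (hθ : Real.sin (2 * θ) ≠ 0) : (γ.dual hθ).StartsAtBase := by
  have hlam : (lam (π / 2 - θ) : ℂ) * (lam θ - 1) = lam θ + 1 := by
    exact_mod_cast congrArg Complex.ofReal (lam_pi_div_two_sub_mul hθ)
  unfold Curve.StartsAtBase at h ⊢
  simp only [Curve.dual, dualCoord, h, map_mul, Complex.conj_I, Complex.conj_ofReal]
  linear_combination I * conj (γ.x 0) * hlam -
    I * lam (π / 2 - θ) * lam θ * conj (γ.x 0) * Complex.I_sq

theorem gaussNum_dualCoord (α β : ℝ) (x y : ℂ) :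
    gaussNum α (π / 2 - β) (dualCoord x y) (dualCoord y x) =
      Real.sqrt 2 * I * conj (gaussNum α β x y) := by
  have hdiff : (α - (π / 2 - β)) / 2 = (α + β) / 2 - π / 4 := by ring
  have hsum : (α + (π / 2 - β)) / 2 = (α - β) / 2 + π / 4 := by ring
  simp only [gaussNum, dualCoord, hdiff, hsum, Real.cos_sub _ (π / 4), Real.sin_sub _ (π / 4),
    Real.cos_add _ (π / 4), Real.sin_add _ (π / 4), Real.cos_pi_div_four, Real.sin_pi_div_four,
    Complex.ofReal_add, Complex.ofReal_sub, Complex.ofReal_mul, Complex.ofReal_div,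
    Complex.ofReal_ofNat, map_add, map_mul, Complex.conj_I, Complex.conj_ofReal]
  linear_combination (Real.sqrt 2 : ℂ) / 2 *
    (conj y * (Real.cos ((α - β) / 2) - Real.sin ((α - β) / 2)) +
      conj x * (Real.sin ((α + β) / 2) - Real.cos ((α + β) / 2))) * Complex.I_sq

theorem gaussNum_add_pi (α β : ℝ) (x y : ℂ) : gaussNum (α + π) β x y = gaussDen α β x y := by
  have hdiff : (α + π - β) / 2 = (α - β) / 2 + π / 2 := by ring
  have hsum : (α + π + β) / 2 = (α + β) / 2 + π / 2 := by ring
  simp only [gaussNum, gaussDen, hdiff, hsum, Real.cos_add_pi_div_two, Real.sin_add_pi_div_two,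
    Complex.ofReal_neg]
  ring

theorem gaussDen_dualCoord (α β : ℝ) (x y : ℂ) :
    gaussDen α (π / 2 - β) (dualCoord x y) (dualCoord y x) =
      Real.sqrt 2 * I * conj (gaussDen α β x y) := by
  simp only [← gaussNum_add_pi, gaussNum_dualCoord]

theorem sqrt_two_mul_I_ne_zero : (Real.sqrt 2 : ℂ) * I ≠ 0 := by simp

theorem gauss_dualCoord (α β : ℝ) (x y : ℂ) :
    gauss α (π / 2 - β) (dualCoord x y) (dualCoord y x) = conj (gauss α β x y) := by
  rw [gauss, gaussNum_dualCoord, gaussDen_dualCoord, mul_div_mul_left _ _ sqrt_two_mul_I_ne_zero,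
    gauss, map_div₀]

theorem Curve.AvoidsEnds.dual {θ : ℝ} {γ : Curve θ} {α β : ℝ} (h : γ.AvoidsEnds α β)
    (hθ : Real.sin (2 * θ) ≠ 0) : (γ.dual hθ).AvoidsEnds α (π / 2 - β) := by
  intro t ht
  simp only [Curve.dual, gaussNum_dualCoord, gaussDen_dualCoord]
  exact ⟨mul_ne_zero sqrt_two_mul_I_ne_zero ((map_ne_zero _).mpr (h t ht).1),
    mul_ne_zero sqrt_two_mul_I_ne_zero ((map_ne_zero _).mpr (h t ht).2)⟩

theorem ellipticK_pos {m : ℝ} (hm : m < 1) : 0 < ellipticK m := by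
  have hpos (u : ℝ) : 0 < 1 - m * Real.sin u ^ 2 := by
    nlinarith [mul_nonneg (sub_nonneg.mpr hm.le) (sq_nonneg (Real.sin u)),
      Real.sin_sq_le_one u]
  have hsqrt (u : ℝ) : 0 < Real.sqrt (1 - m * Real.sin u ^ 2) := Real.sqrt_pos.mpr (hpos u)
  refine intervalIntegral.intervalIntegral_pos_of_pos ?_ (fun u => one_div_pos.mpr (hsqrt u))
    Real.pi_div_two_pos
  have hcont : Continuous fun u : ℝ => 1 / Real.sqrt (1 - m * Real.sin u ^ 2) :=
    continuous_const.div (by fun_prop) fun u => (hsqrt u).ne'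
  exact hcont.intervalIntegrable _ _

theorem ellipticK_sin_sq_pos {θ : ℝ} (hθ : Real.cos θ ≠ 0) : 0 < ellipticK (Real.sin θ ^ 2) :=
  ellipticK_pos (by linarith [Real.sin_sq_add_cos_sq θ, sq_pos_of_ne_zero hθ])

theorem mu_ne_zero {θ : ℝ} (hθ : Real.sin (2 * θ) ≠ 0) : mu θ ≠ 0 :=
  div_ne_zero Real.pi_ne_zero (mul_ne_zero (sin_ne_zero_of_sin_two_mul_ne_zero hθ)
    (ellipticK_sin_sq_pos (cos_ne_zero_of_sin_two_mul_ne_zero hθ)).ne')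

/-- The ratio of the homothety that relates the surfaces with parameters `θ` and `π / 2 - θ`. -/
noncomputable def dualRatio (θ : ℝ) : ℝ := mu (π / 2 - θ) / (mu θ * Real.tan θ)

theorem dualRatio_eq_ellipticK_div {θ : ℝ} (hθ : Real.sin (2 * θ) ≠ 0) :
    dualRatio θ = ellipticK (Real.sin θ ^ 2) / ellipticK (Real.cos θ ^ 2) := by
  have hs := sin_ne_zero_of_sin_two_mul_ne_zero hθ
  have hc := cos_ne_zero_of_sin_two_mul_ne_zero hθ
  have hK := (ellipticK_sin_sq_pos hc).ne'
  rw [dualRatio, mu, mu, Real.sin_pi_div_two_sub, Real.tan_eq_sin_div_cos]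
  field_simp

theorem dualRatio_pos {θ : ℝ} (hθ : Real.sin (2 * θ) ≠ 0) : 0 < dualRatio θ := by
  have hcos : Real.cos (π / 2 - θ) ≠ 0 := by
    rw [Real.cos_pi_div_two_sub]
    exact sin_ne_zero_of_sin_two_mul_ne_zero hθ
  rw [dualRatio_eq_ellipticK_div hθ, ← Real.sin_pi_div_two_sub]
  exact div_pos (ellipticK_sin_sq_pos (cos_ne_zero_of_sin_two_mul_ne_zero hθ))
    (ellipticK_sin_sq_pos hcos)

theorem dualRatio_mul_dualRatio_pi_div_two_sub {θ : ℝ} (hθ : Real.sin (2 * θ) ≠ 0) :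
    dualRatio θ * dualRatio (π / 2 - θ) = 1 := by
  have hθ' : Real.sin (2 * (π / 2 - θ)) ≠ 0 := by rwa [sin_two_mul_pi_div_two_sub]
  rw [← mul_inv_cancel₀ (dualRatio_pos hθ).ne', dualRatio_eq_ellipticK_div hθ',
    dualRatio_eq_ellipticK_div hθ, Real.sin_pi_div_two_sub, Real.cos_pi_div_two_sub, inv_div]

theorem mu_pi_div_two_sub_mul_cot {θ : ℝ} (hθ : Real.sin (2 * θ) ≠ 0) :
    mu (π / 2 - θ) * Real.cot θ = dualRatio θ * mu θ := by
  have hmu := mu_ne_zero hθ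
  have htan := tan_ne_zero_of_sin_two_mul_ne_zero hθ
  rw [← Real.tan_inv_eq_cot, dualRatio]
  field_simp

/-- The diagonal entries of the reflection in the plane `x₂ = 0`. -/
def reflectionSign : Fin 3 → ℝ := ![1, -1, 1]

theorem reflectX2_zero_apply (X : EuclideanSpace ℝ (Fin 3)) (j : Fin 3) :
    reflectX2 0 X j = reflectionSign j * X j := by
  fin_cases j <;> simp [reflectX2, reflectionSign]

theorem reflectionSign_mul_self (j : Fin 3) : reflectionSign j * reflectionSign j = 1 := by
  fin_cases j <;> simp [reflectionSign]

/-- The homothety of ratio `r` followed by the reflection in the plane `x₂ = 0`, as an additive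
map so that it can be applied to period groups. -/
def scaledReflection (r : ℝ) : EuclideanSpace ℝ (Fin 3) →+ EuclideanSpace ℝ (Fin 3) :=
  AddMonoidHom.mk' (fun X => reflectX2 0 (r • X)) fun X Y => by
    ext j
    simp only [reflectX2_zero_apply, PiLp.add_apply, PiLp.smul_apply, smul_eq_mul]
    ring

theorem scaledReflection_apply (r : ℝ) (X : EuclideanSpace ℝ (Fin 3)) (j : Fin 3) :
    scaledReflection r X j = reflectionSign j * (r * X j) :=
  reflectX2_zero_apply (r • X) j

theorem leftInverse_scaledReflection {r s : ℝ} (h : r * s = 1) :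
    Function.LeftInverse (scaledReflection r) (scaledReflection s) := by
  intro X
  ext j
  rw [scaledReflection_apply, scaledReflection_apply]
  linear_combination X j * r * s * reflectionSign_mul_self j + X j * h

theorem weierstrassCoeff_conj (g : ℂ) (j : Fin 3) :
    weierstrassCoeff (conj g) j = reflectionSign j * conj (weierstrassCoeff g j) := by
  fin_cases j <;> simp [weierstrassCoeff, reflectionSign, Complex.conj_ofNat, neg_div]

theorem weierstrassCoeff_mul_vel_dual {θ : ℝ} (hθ : Real.sin (2 * θ) ≠ 0) (α β : ℝ) (γ : Curve θ)
    (t : ℝ) (j : Fin 3) :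
    weierstrassCoeff (gauss α (π / 2 - β) ((γ.dual hθ).x t) ((γ.dual hθ).y t)) j *
        ((mu (π / 2 - θ) : ℂ) * (γ.dual hθ).vel t) =
      ((reflectionSign j * dualRatio θ : ℝ) : ℂ) *
        conj (I * (weierstrassCoeff (gauss α β (γ.x t) (γ.y t)) j * ((mu θ : ℂ) * γ.vel t))) := by
  have hmu : (mu (π / 2 - θ) : ℂ) * Real.cot θ = dualRatio θ * mu θ := by
    exact_mod_cast congrArg Complex.ofReal (mu_pi_div_two_sub_mul_cot hθ)
  simp only [Curve.dual, gauss_dualCoord, weierstrassCoeff_conj, map_mul, Complex.conj_ofReal,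
    Complex.ofReal_mul]
  linear_combination reflectionSign j * conj (weierstrassCoeff (gauss α β (γ.x t) (γ.y t)) j) *
    conj I * conj (γ.vel t) * hmu

theorem displacement_dual {θ : ℝ} (hθ : Real.sin (2 * θ) ≠ 0) (κ : ℂ) (α β : ℝ) (γ : Curve θ) :
    displacement κ α (π / 2 - β) (γ.dual hθ) =
      scaledReflection (dualRatio θ) (displacement (I * conj κ) α β γ) := by
  ext j
  simp only [scaledReflection_apply, displacement, weierstrassCoeff_mul_vel_dual,
    intervalIntegral.integral_const_mul, intervalIntegral.intervalIntegral_conj]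
  rw [mul_left_comm κ, Complex.re_ofReal_mul, mul_assoc (reflectionSign j), ← Complex.conj_re]
  simp only [map_mul, Complex.conj_conj, mul_left_comm, mul_assoc]

theorem mapsTo_lift_dual {θ : ℝ} (hθ : Real.sin (2 * θ) ≠ 0) (κ : ℂ) (α β : ℝ) :
    MapsTo (scaledReflection (dualRatio θ)) (associateSurface (I * conj κ) θ α β).lift
      (associateSurface κ (π / 2 - θ) α (π / 2 - β)).lift := by
  rintro _ ⟨γ, hends, hbase, rfl⟩
  exact ⟨γ.dual hθ, hends.dual hθ, hbase.dual hθ, (displacement_dual hθ κ α β γ).symm⟩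

theorem mapsTo_periods_dual {θ : ℝ} (hθ : Real.sin (2 * θ) ≠ 0) (κ : ℂ) (α β : ℝ) :
    MapsTo (scaledReflection (dualRatio θ)) (associateSurface (I * conj κ) θ α β).periods
      (associateSurface κ (π / 2 - θ) α (π / 2 - β)).periods := by
  suffices (associateSurface (I * conj κ) θ α β).periods ≤
      (associateSurface κ (π / 2 - θ) α (π / 2 - β)).periods.comap
        (scaledReflection (dualRatio θ)) from this
  refine (AddSubgroup.closure_le _).mpr ?_
  rintro _ ⟨γ, hends, hclosed, rfl⟩
  exact AddSubgroup.subset_closure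
    ⟨γ.dual hθ, hends.dual hθ, hclosed.dual hθ, (displacement_dual hθ κ α β γ).symm⟩

/-- The reverse inclusion is the hypothesis at the dual parameters, since duality is an
involution. -/
theorem image_scaledReflection_eq_of_mapsTo
    {S : ℂ → ℝ → ℝ → Set (EuclideanSpace ℝ (Fin 3))}
    (hS : ∀ κ θ β, Real.sin (2 * θ) ≠ 0 → MapsTo (scaledReflection (dualRatio θ))
      (S (I * conj κ) θ β) (S κ (π / 2 - θ) (π / 2 - β)))
    {θ : ℝ} (hθ : Real.sin (2 * θ) ≠ 0) (κ : ℂ) (β : ℝ) :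
    scaledReflection (dualRatio θ) '' S (I * conj κ) θ β = S κ (π / 2 - θ) (π / 2 - β) := by
  have hθ' : Real.sin (2 * (π / 2 - θ)) ≠ 0 := by rwa [sin_two_mul_pi_div_two_sub]
  have hκ : I * conj (I * conj κ) = κ := by simp [← mul_assoc]
  have hback : MapsTo (scaledReflection (dualRatio (π / 2 - θ)))
      (S κ (π / 2 - θ) (π / 2 - β)) (S (I * conj κ) θ β) := by
    simpa only [hκ, sub_sub_cancel] using hS (I * conj κ) (π / 2 - θ) (π / 2 - β) hθ'
  have hratio := dualRatio_mul_dualRatio_pi_div_two_sub hθ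
  have hratio' : dualRatio (π / 2 - θ) * dualRatio θ = 1 := by rwa [mul_comm]
  have hinv : InvOn (scaledReflection (dualRatio (π / 2 - θ))) (scaledReflection (dualRatio θ))
      (S (I * conj κ) θ β) (S κ (π / 2 - θ) (π / 2 - β)) :=
    ⟨(leftInverse_scaledReflection hratio').leftInvOn _,
      (leftInverse_scaledReflection hratio).leftInvOn _⟩
  exact (hinv.bijOn (hS κ θ β hθ) hback).image_eq

theorem sin_two_mul_ne_zero_of_mem_paramRange {θ α β : ℝ} (h : (θ, α, β) ∈ paramRange) :
    Real.sin (2 * θ) ≠ 0 := by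
  have hθ : θ ∈ Ioo 0 (π / 2) := h.1
  exact (Real.sin_pos_of_pos_of_lt_pi (by linarith [hθ.1]) (by linarith [hθ.2])).ne'

theorem dual_mem_paramRange {θ α β : ℝ} (h : (θ, α, β) ∈ paramRange) :
    (π / 2 - θ, α, π / 2 - β) ∈ paramRange := by
  obtain ⟨hθ, hα, hβ, hne⟩ := h
  refine ⟨⟨by linarith [hθ.2], by linarith [hθ.1]⟩, hα,
    ⟨by linarith [hβ.2], by linarith [hβ.1]⟩, fun heq => hne ?_⟩
  obtain ⟨hα0, hβθ⟩ := Prod.mk.inj heq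
  exact Prod.ext hα0 (sub_right_injective hβθ)

end StandardExamples

theorem mainTheorem8_general {θ : ℝ} (hθ : Real.sin (2 * θ) ≠ 0) (κ : ℂ) (α β : ℝ) :
    0 < mu (Real.pi / 2 - θ) / (mu θ * Real.tan θ) ∧
      CoincideUpToReflection (mu (Real.pi / 2 - θ) / (mu θ * Real.tan θ))
        (associateSurface (Complex.I * starRingEnd ℂ κ) θ α β)
        (associateSurface κ (Real.pi / 2 - θ) α (Real.pi / 2 - β)) :=
  ⟨dualRatio_pos hθ, 0,
    (image_scaledReflection_eq_of_mapsTo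
      (S := fun κ θ β => (associateSurface κ θ α β).lift)
      (fun κ _ β hθ => mapsTo_lift_dual hθ κ α β) hθ κ β).symm,
    (image_scaledReflection_eq_of_mapsTo
      (S := fun κ θ β => (associateSurface κ θ α β).periods)
      (fun κ _ β hθ => mapsTo_periods_dual hθ κ α β) hθ κ β).symm⟩

theorem mainTheorem8 :
    (∀ θ α β : ℝ, (θ, α, β) ∈ paramRange →
      (Real.pi / 2 - θ, α, Real.pi / 2 - β) ∈ paramRange ∧
      0 < mu (Real.pi / 2 - θ) / (mu θ * Real.tan θ) ∧
      CoincideUpToReflection (mu (Real.pi / 2 - θ) / (mu θ * Real.tan θ))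
        (conjugateExample θ α β)
        (standardExample (Real.pi / 2 - θ) α (Real.pi / 2 - β))) ∧
    (∀ θ α β : ℝ, (θ, α, β) ∈ paramRange →
      ∃ θ' α' β' : ℝ, (θ', α', β') ∈ paramRange ∧
        ∃ r : ℝ, 0 < r ∧
          CoincideUpToReflection r (conjugateExample θ α β) (standardExample θ' α' β')) ∧
    (∀ θ' α' β' : ℝ, (θ', α', β') ∈ paramRange →
      ∃ θ α β : ℝ, (θ, α, β) ∈ paramRange ∧
        ∃ r : ℝ, 0 < r ∧
          CoincideUpToReflection r (conjugateExample θ α β) (standardExample θ' α' β')) := by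
  have dual (θ α β : ℝ) (h : (θ, α, β) ∈ paramRange) :
      0 < mu (Real.pi / 2 - θ) / (mu θ * Real.tan θ) ∧
        CoincideUpToReflection (mu (Real.pi / 2 - θ) / (mu θ * Real.tan θ))
          (conjugateExample θ α β) (standardExample (Real.pi / 2 - θ) α (Real.pi / 2 - β)) := by
    simpa only [map_one, mul_one, conjugateExample, standardExample] using
      mainTheorem8_general (sin_two_mul_ne_zero_of_mem_paramRange h) 1 α β
  refine ⟨fun θ α β h => ⟨dual_mem_paramRange h, dual θ α β h⟩,
    fun θ α β h => ⟨_, _, _, dual_mem_paramRange h, _, dual θ α β h⟩,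
    fun θ α β h => ?_⟩
  have hdual := dual _ _ _ (dual_mem_paramRange h)
  simp only [sub_sub_cancel] at hdual
  exact ⟨_, _, _, dual_mem_paramRange h, _, hdual⟩
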